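/- For every integer $n\ge 5$ there exists a loopless multigraph with $n$ vertices and $5n-10$ edges that is $1$-gap-planar (in the sense of multigraphs, where homotopic parallel edges are forbidden). Here a drawing $\Gamma$ of a multigraph $G=(V,E)$ maps the vertices to distinct points of $\mathbb{R}^2$ and each edge to a continuous curve $[0,1]\to\mathbb{R}^2$ joining its two endpoints, such that the interior of no edge passes through a vertex, edges meet at common interior points only by crossing transversely, and no point is passed through more than twice by the interiors of edges (an edge may cross itself, and two edges may cross several times). A point passed through twice is a crossing, and the edges passing through it are responsible for it. A $k$-gap assignment of $\Gamma$ maps each crossing to an edge responsible for it so that each edge is assigned at most $k$ crossings. Two parallel edges with common endpoints $u,v$, drawn as curves $\gamma_1,\gamma_2:[0,1]\to\mathbb{R}^2$ from $u$ to $v$, are homotopic in $\Gamma$ if there is a continuous $h:[0,1]^2\to\mathbb{R}^2$ with $h(0,t)=\gamma_1(t)$, $h(1,t)=\gamma_2(t)$, $h(t,0)=\Gamma(u)$ and $h(t,1)=\Gamma(v)$ for all $t\in[0,1]$, such that $h$ maps no point of $(0,1)^2$ to a vertex of $\Gamma$. A multigraph is $k$-gap-planar if it has a drawing that admits a $k$-gap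 assignment and in which no two parallel edges are homotopic. -/

import Mathlib

open scoped unitInterval

namespace GapPlanar

/-- The Euclidean plane, as a topological space. -/
abbrev Plane : Type := ℝ × ℝ

/-- The curve `γ` at the parameter `s` and the curve `δ` at the parameter `t` cross transversely:
they meet there, and some local homeomorphism of the plane, defined near the common point, carries
`γ` near `s` to the first coordinate axis and `δ` near `t` to the second one, each traversed
injectively through the origin (the axes can always be rescaled so that the speed is one). -/
def CrossTransversely (γ δ : C(I, Plane)) (s t : I) : Prop :=
  γ s = δ t ∧
    ∃ φ : OpenPartialHomeomorph Plane Plane, γ s ∈ φ.source ∧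
      (∀ᶠ s' in nhds s, φ (γ s') = ((s' : ℝ) - (s : ℝ), 0)) ∧
      (∀ᶠ t' in nhds t, φ (δ t') = (0, (t' : ℝ) - (t : ℝ)))

universe u v

variable {α : Type u} {β : Type v}

/-- A drawing of a multigraph in the plane. Vertices are distinct points; an edge is a continuous
curve joining its two ends, whose interior contains no vertex. Edges may cross each other several
times and may cross themselves. A pair `(e, t)` with `0 < t < 1` is a passage of the edge `e`
through the point `arc e t`; two different passages through a point (of two edges, or of one edge)
cross transversely there, and no point has three passages. -/
structure Drawing (G : Graph α β) where
  pos : G.vertexSet → Plane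
  pos_injective : Function.Injective pos
  arc : G.edgeSet → C(I, Plane)
  arc_ends : ∀ e : G.edgeSet, ∃ x y : G.vertexSet,
    G.IsLink e.1 x.1 y.1 ∧ arc e 0 = pos x ∧ arc e 1 = pos y
  arc_ne_pos : ∀ (e : G.edgeSet) (t : I), t ∈ Set.Ioo (0 : I) 1 →
    ∀ x : G.vertexSet, arc e t ≠ pos x
  transverse : ∀ (e f : G.edgeSet) (s t : I), s ∈ Set.Ioo (0 : I) 1 → t ∈ Set.Ioo (0 : I) 1 →
    (e, s) ≠ (f, t) → arc e s = arc f t → CrossTransversely (arc e) (arc f) s t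
  no_three : ∀ p : Plane,
    {q : G.edgeSet × I | q.2 ∈ Set.Ioo (0 : I) 1 ∧ arc q.1 q.2 = p}.encard ≤ 2

namespace Drawing

variable {G : Graph α β} (D : Drawing G)

/-- The crossing points: the points with two different passages of edges. -/
def crossings : Set Plane :=
  {p | ∃ (e f : G.edgeSet) (s t : I), s ∈ Set.Ioo (0 : I) 1 ∧ t ∈ Set.Ioo (0 : I) 1 ∧
    (e, s) ≠ (f, t) ∧ D.arc e s = p ∧ D.arc f t = p}

/-- The edge `e` is responsible for the point `p` if its interior passes through `p`. -/
def Responsible (e : G.edgeSet) (p : Plane) : Prop :=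
  ∃ t : I, t ∈ Set.Ioo (0 : I) 1 ∧ D.arc e t = p

/-- A `k`-gap assignment maps each crossing to an edge responsible for it, in such a way that every
edge receives at most `k` crossings. -/
def IsGapAssignment (k : ℕ) (g : D.crossings → G.edgeSet) : Prop :=
  (∀ p : D.crossings, D.Responsible (g p) p.1) ∧
    ∀ e : G.edgeSet, {p : D.crossings | g p = e}.encard ≤ k

/-- Two edges are homotopic in the drawing if the curve of one can be deformed continuously into
the curve of the other (which may have to be traversed backwards, edges being undirected) with
fixed endpoints and without passing through a vertex. -/
def Homotopic (e f : G.edgeSet) : Prop :=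
  ∃ h : C(I × I, Plane),
    (∀ t, h (0, t) = D.arc e t) ∧
    ((∀ t, h (1, t) = D.arc f t) ∨ (∀ t, h (1, t) = D.arc f (unitInterval.symm t))) ∧
    (∀ s, h (s, 0) = D.arc e 0) ∧
    (∀ s, h (s, 1) = D.arc e 1) ∧
    ∀ s ∈ Set.Ioo (0 : I) 1, ∀ t ∈ Set.Ioo (0 : I) 1, ∀ x : G.vertexSet, h (s, t) ≠ D.pos x

end Drawing

/-- Two different edges with the same ends. -/
def AreParallel (G : Graph α β) (e f : β) : Prop :=
  e ≠ f ∧ ∃ x y, G.IsLink e x y ∧ G.IsLink f x y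

/-- A drawing is `k`-gap-planar if it admits a `k`-gap assignment and no two parallel edges are
homotopic. -/
def Drawing.IsGapPlanar {G : Graph α β} (D : Drawing G) (k : ℕ) : Prop :=
  (∃ g : D.crossings → G.edgeSet, D.IsGapAssignment k g) ∧
    ∀ e f : G.edgeSet, AreParallel G e.1 f.1 → ¬ D.Homotopic e f

/-- A multigraph is `k`-gap-planar if it has a `k`-gap-planar drawing. -/
def IsGapPlanar (G : Graph α β) (k : ℕ) : Prop :=
  ∃ D : Drawing G, D.IsGapPlanar k

end GapPlanar

/-! One infinite drawing serves every `n`: the graph for `n` is the part induced on the vertices `0,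
…, n - 1`. Vertex `0` sits at `(0, 1)`, the others on the horizontal axis. The edges are a path, the
spine (`n - 1` edges); an upper and a lower fan edge from `0` to each vertex from `2` on (`2(n -
2)`); an upper and a lower tent from `i + 1` to `i + 3` (`2(n - 3)`); and one extra edge from `0` to
`3`, passing above `1` and below `2`. The total is `5n - 10`.

A fan edge is so steep that it stays outside the tents until its vertical last leg. Hence the only
possible crossings are one fan–tent crossing per fan edge, those of consecutive tents on the same
side, and four on the extra edge (`Crossing.exists_of_trace`). These can be charged to pairwise
different edges (`Crossing.owner_injective`), which is a 1-gap assignment.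

Two parallel edges pass on opposite sides of some intermediate vertex (`Edge.exists_separating`).
Their angular changes around it differ by a full turn, so every deformation of one into the other
hits that vertex (`ne_of_above_below`). -/

namespace GapPlanar

/-! ### Curves separated by a point are not homotopic in its complement -/

section Separation

/-- Two continuous paths in `ℂ` whose exponentials have constant ratio differ by a constant. -/
lemma sub_eq_sub_of_exp_eq_mul {F G : I → ℂ} (hF : Continuous F) (hG : Continuous G) (c : ℂ)
    (h : ∀ t, Complex.exp (F t) = c * Complex.exp (G t)) : F 1 - F 0 = G 1 - G 0 := by
  have hc : c = Complex.exp (F 0 - G 0) := by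
    rw [Complex.exp_sub, h 0, mul_div_cancel_right₀ _ (Complex.exp_ne_zero _)]
  have key := Complex.isCoveringMap_exp.eq_of_comp_eq (g₁ := F) (g₂ := fun t => F 0 - G 0 + G t)
    hF (by fun_prop) (by
      funext t
      apply Subtype.ext
      simp [h t, hc, Complex.exp_add]) 0 (by ring)
  have := congrFun key 1
  rw [this]; ring

/-- If `h` missed `w`, a logarithm of `h - w` would lift through `exp` and be constant along the two
sides where `h` is constant. The first and last curves would then turn by the same angle around `w`,
but one goes over it and the other under it, a difference of `2π`. -/
lemma ne_of_above_below {w : Plane} {A B : Plane} (hA : A.1 < w.1) (hB : w.1 < B.1)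
    (h : C(I × I, Plane)) (h0 : ∀ s, h (s, 0) = A) (h1 : ∀ s, h (s, 1) = B)
    (habove : ∀ t, (h (0, t)).1 = w.1 → w.2 < (h (0, t)).2)
    (hbelow : ∀ t, (h (1, t)).1 = w.1 → (h (1, t)).2 < w.2) :
    ∃ s t, h (s, t) = w := by
  by_contra! hne
  -- rotate so that the upward direction becomes the positive real axis
  let Q : Plane → ℂ := fun p => ⟨p.2 - w.2, -(p.1 - w.1)⟩
  have hQc : Continuous Q := by
    have : Q = fun p : Plane => ((p.2 - w.2 : ℝ) : ℂ) + ((-(p.1 - w.1) : ℝ) : ℂ) * Complex.I := by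
      funext p; apply Complex.ext <;> simp [Q]
    rw [this]; fun_prop
  have hQ0 : ∀ p, p ≠ w → Q p ≠ 0 := by
    intro p hp hq
    apply hp
    have h1 := congrArg Complex.re hq
    have h2 := congrArg Complex.im hq
    simp [Q] at h1 h2
    exact Prod.ext (by linarith) (by linarith)
  -- The first curve misses the vertical ray below `w`, which `Q` sends to the negative real axis,
  -- so the principal logarithm is continuous along it. The last curve misses the ray above, hence
  -- the sign in `slit1`.
  have slit0 : ∀ t, Q (h (0, t)) ∈ Complex.slitPlane := by
    intro t
    rw [Complex.mem_slitPlane_iff]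
    by_cases hx : (h (0, t)).1 = w.1
    · left; have := habove t hx; simp [Q, this]
    · right; simp only [Q]; intro h'; apply hx; linarith
  have slit1 : ∀ t, -Q (h (1, t)) ∈ Complex.slitPlane := by
    intro t
    rw [Complex.mem_slitPlane_iff]
    by_cases hx : (h (1, t)).1 = w.1
    · left; have := hbelow t hx; simp [Q, this]
    · right; simp only [Q, Complex.neg_im]; intro h'; apply hx; linarith
  let H : C(I × I, {z : ℂ // z ≠ 0}) :=
    ⟨fun p => ⟨Q (h p), hQ0 _ (hne p.1 p.2)⟩, by fun_prop⟩
  let f : C(I, ℂ) := ⟨fun t => Complex.log (Q (h (0, t))),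
    Continuous.clog (by fun_prop) slit0⟩
  have H0 : ∀ t, H (0, t) = ⟨Complex.exp (f t), Complex.exp_ne_zero _⟩ := fun t =>
    Subtype.ext (Complex.exp_log (hQ0 _ (hne 0 t))).symm
  let L := Complex.isCoveringMap_exp.liftHomotopy H f H0
  have hL : ∀ p, Complex.exp (L p) = Q (h p) := fun p =>
    congrArg Subtype.val (congrFun (Complex.isCoveringMap_exp.liftHomotopy_lifts H f H0) p)
  have hL0 : ∀ t, L (0, t) = Complex.log (Q (h (0, t))) := fun t =>
    Complex.isCoveringMap_exp.liftHomotopy_zero H f H0 t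
  have e0 : L (1, 0) = L (0, 0) := by
    have := sub_eq_sub_of_exp_eq_mul (F := fun s => L (s, 0)) (G := fun _ => L (0, 0))
      (by fun_prop) (by fun_prop) 1 (by intro s; rw [hL, hL, h0, h0, one_mul])
    simpa [sub_eq_zero] using this
  have e1 : L (1, 1) = L (0, 1) := by
    have := sub_eq_sub_of_exp_eq_mul (F := fun s => L (s, 1)) (G := fun _ => L (0, 1))
      (by fun_prop) (by fun_prop) 1 (by intro s; rw [hL, hL, h1, h1, one_mul])
    simpa [sub_eq_zero] using this
  have e2 := sub_eq_sub_of_exp_eq_mul (F := fun t => L (1, t))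
    (G := fun t => Complex.log (-Q (h (1, t)))) (by fun_prop)
    (Continuous.clog (by fun_prop) slit1) (-1)
    (by intro t; rw [hL, Complex.exp_log (neg_ne_zero.2 (hQ0 _ (hne 1 t)))]; ring)
  simp only [e0, e1, hL0, h0, h1] at e2
  have e3 := congrArg Complex.im e2
  simp only [Complex.sub_im, Complex.log_im] at e3
  -- `A` and `B` lie on opposite sides of the vertical line through `w`, so negation shifts the two
  -- arguments by `π` in opposite directions.
  rw [Complex.arg_neg_eq_arg_add_pi_of_im_neg (x := Q B) (by simp [Q, hB]),
    Complex.arg_neg_eq_arg_sub_pi_of_im_pos (x := Q A) (by simp [Q, hA])] at e3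
  linarith [Real.pi_pos]

end Separation

/-! ### Polygonal curves with one corner -/

section Bent

/-- The polygonal curve from `A` to `B` with one corner `M`, reached at time `1/2`. -/
def bent (A M B : Plane) : C(I, Plane) where
  toFun t := A + min (2 * (t : ℝ)) 1 • (M - A) + max (2 * (t : ℝ) - 1) 0 • (B - M)
  continuous_toFun := by fun_prop

lemma bent_of_le {A M B : Plane} {t : I} (h : (t : ℝ) ≤ 1 / 2) :
    bent A M B t = A + (2 * (t : ℝ)) • (M - A) := by
  change A + min (2 * (t : ℝ)) 1 • (M - A) + max (2 * (t : ℝ) - 1) 0 • (B - M) = _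
  rw [min_eq_left (by linarith), max_eq_right (by linarith), zero_smul, add_zero]

lemma bent_of_ge {A M B : Plane} {t : I} (h : 1 / 2 ≤ (t : ℝ)) :
    bent A M B t = M + (2 * (t : ℝ) - 1) • (B - M) := by
  change A + min (2 * (t : ℝ)) 1 • (M - A) + max (2 * (t : ℝ) - 1) 0 • (B - M) = _
  rw [min_eq_right (by linarith), max_eq_left (by linarith), one_smul, add_sub_cancel]

lemma bent_zero (A M B : Plane) : bent A M B 0 = A := by
  rw [bent_of_le (by norm_num)]; simp

lemma bent_one (A M B : Plane) : bent A M B 1 = B := by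
  rw [bent_of_ge (by norm_num)]; norm_num

/-- The curve `γ` moves with constant velocity `v` near the parameter `s`. -/
def HasLocalVelocity (γ : C(I, Plane)) (s : I) (v : Plane) : Prop :=
  ∀ᶠ s' in nhds s, γ s' = γ s + ((s' : ℝ) - s) • v

lemma hasLocalVelocity_bent_of_lt {A M B : Plane} {t : I} (h : (t : ℝ) < 1 / 2) :
    HasLocalVelocity (bent A M B) t ((2 : ℝ) • (M - A)) := by
  have : ∀ᶠ s' : I in nhds t, (s' : ℝ) < 1 / 2 :=
    continuous_subtype_val.continuousAt.eventually (gt_mem_nhds h)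
  filter_upwards [this] with s' hs'
  rw [bent_of_le hs'.le, bent_of_le h.le]
  module

lemma hasLocalVelocity_bent_of_gt {A M B : Plane} {t : I} (h : 1 / 2 < (t : ℝ)) :
    HasLocalVelocity (bent A M B) t ((2 : ℝ) • (B - M)) := by
  have : ∀ᶠ s' : I in nhds t, 1 / 2 < (s' : ℝ) :=
    continuous_subtype_val.continuousAt.eventually (lt_mem_nhds h)
  filter_upwards [this] with s' hs'
  rw [bent_of_ge hs'.le, bent_of_ge h.le]
  module

/-- The affine homeomorphism of the plane taking `p` to the origin and the independent vectors
`v`, `w` to the unit vectors. -/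
noncomputable def straighten (p v w : Plane) (hd : v.1 * w.2 - v.2 * w.1 ≠ 0) :
    Plane ≃ₜ Plane where
  toFun q := (((q.1 - p.1) * w.2 - (q.2 - p.2) * w.1) / (v.1 * w.2 - v.2 * w.1),
    (v.1 * (q.2 - p.2) - v.2 * (q.1 - p.1)) / (v.1 * w.2 - v.2 * w.1))
  invFun q := (p.1 + q.1 * v.1 + q.2 * w.1, p.2 + q.1 * v.2 + q.2 * w.2)
  left_inv q := by
    generalize h : v.1 * w.2 - v.2 * w.1 = d at hd
    ext <;> (dsimp only; field_simp; rw [← h]; ring)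
  right_inv q := by
    generalize h : v.1 * w.2 - v.2 * w.1 = d at hd
    ext <;> (dsimp only; field_simp; rw [← h]; ring)
  continuous_toFun := by fun_prop
  continuous_invFun := by fun_prop

lemma HasLocalVelocity.crossTransversely {γ δ : C(I, Plane)} {s t : I} {v w : Plane}
    (hγ : HasLocalVelocity γ s v) (hδ : HasLocalVelocity δ t w) (hp : γ s = δ t)
    (hd : v.1 * w.2 - v.2 * w.1 ≠ 0) : CrossTransversely γ δ s t := by
  refine ⟨hp, (straighten (γ s) v w hd).toOpenPartialHomeomorph, trivial, ?_, ?_⟩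
  · filter_upwards [hγ] with s' hs'
    rw [hs']
    ext
    · simp [straighten]; field_simp
    · simp [straighten]; left; ring
  · filter_upwards [hδ] with s' hs'
    rw [hs', ← hp]
    ext
    · simp [straighten]; left; ring
    · simp [straighten]; field_simp

lemma CrossTransversely.symm {γ δ : C(I, Plane)} {s t : I} (h : CrossTransversely γ δ s t) :
    CrossTransversely δ γ t s := by
  obtain ⟨hp, φ, hs, h1, h2⟩ := h
  refine ⟨hp.symm, φ.trans (Homeomorph.prodComm ℝ ℝ).toOpenPartialHomeomorph, ?_, ?_, ?_⟩
  · simpa [← hp] using hs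
  · filter_upwards [h2] with t' ht'
    simp [ht']
  · filter_upwards [h1] with t' ht'
    simp [ht']

end Bent

section BentLegs

variable {A M B : Plane} {t : I}

lemma lt_half_of_bent_fst_lt (hMB : M.1 ≤ B.1) (h : (bent A M B t).1 < M.1) :
    (t : ℝ) < 1 / 2 := by
  by_contra! ht
  rw [bent_of_ge ht] at h
  simp only [Prod.fst_add, Prod.smul_fst, Prod.fst_sub, smul_eq_mul] at h
  nlinarith

/-- The inequality is weak because the last leg of a fan edge is vertical, with the abscissa of the
corner throughout; the corner must then be excluded separately. -/
lemma half_lt_of_le_bent_fst (hAM : A.1 < M.1) (h : M.1 ≤ (bent A M B t).1)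
    (hne : bent A M B t ≠ M) : 1 / 2 < (t : ℝ) := by
  by_contra! ht
  have h' := h
  rw [bent_of_le ht] at h'
  simp only [Prod.fst_add, Prod.smul_fst, Prod.fst_sub, smul_eq_mul] at h'
  have h2 : 2 * (t : ℝ) = 1 := by nlinarith
  apply hne
  rw [bent_of_le ht, h2]; simp

lemma bent_injective (hAM : A.1 < M.1) (hMB : M.1 ≤ B.1) (hne : M ≠ B) :
    Function.Injective (bent A M B) := by
  have key : ∀ {s t : I}, bent A M B s = bent A M B t → (s : ℝ) < 1 / 2 → s = t := by
    intro s t h hs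
    have ht : (t : ℝ) < 1 / 2 := by
      apply lt_half_of_bent_fst_lt hMB (A := A)
      rw [← h, bent_of_le hs.le]
      simp only [Prod.fst_add, Prod.smul_fst, Prod.fst_sub, smul_eq_mul]
      nlinarith
    rw [bent_of_le hs.le, bent_of_le ht.le] at h
    have h1 := congrArg Prod.fst h
    simp only [Prod.fst_add, Prod.smul_fst, Prod.fst_sub, smul_eq_mul] at h1
    have h2 : ((s : ℝ) - t) * (M.1 - A.1) = 0 := by linarith
    rcases mul_eq_zero.1 h2 with h3 | h3
    · exact Subtype.ext (by linarith)
    · linarith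
  intro s t h
  by_cases hs : (s : ℝ) < 1 / 2
  · exact key h hs
  by_cases ht : (t : ℝ) < 1 / 2
  · exact (key h.symm ht).symm
  rw [bent_of_ge (not_lt.1 hs), bent_of_ge (not_lt.1 ht)] at h
  have h2 := smul_left_injective ℝ (sub_ne_zero.2 hne.symm) (add_left_cancel h)
  exact Subtype.ext (by linarith)

end BentLegs

/-! ### The edges and their curves -/

/-- The edges of the infinite multigraph on `ℕ` all of whose finite initial pieces are drawn. -/
inductive Edge : Type
  | spine (i : ℕ)
  | fan (up : Bool) (j : ℕ)
  | tent (up : Bool) (i : ℕ)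
  | extra

/-- `1` for the upper, `-1` for the lower side. -/
def side (up : Bool) : ℝ := if up then 1 else -1

@[simp] lemma side_true : side true = 1 := rfl
@[simp] lemma side_false : side false = -1 := rfl

/-- The position of the vertex `k`. -/
def vertexPos (k : ℕ) : Plane := (k, if k = 0 then 1 else 0)

lemma vertexPos_injective : Function.Injective vertexPos := fun a b h => by
  have : (a : ℝ) = b := congrArg Prod.fst h
  exact_mod_cast this

namespace Edge

/-- The end of smaller index. -/
def left : Edge → ℕ
  | spine i => i
  | fan _ _ => 0
  | tent _ i => i + 1
  | extra => 0

/-- The end of larger index. -/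
def right : Edge → ℕ
  | spine i => i + 1
  | fan _ j => j + 2
  | tent _ i => i + 3
  | extra => 3

/-- The corner of the polygonal curve that draws the edge. -/
noncomputable def corner : Edge → Plane
  | spine i => (i + 1 / 3, if i = 0 then 2 / 3 else 0)
  | fan up j => (j + 2, 1 + side up * ((j + 3) * (j + 2)))
  | tent up i => (i + 5 / 2, side up)
  | extra => (5 / 2, -2 / 3)

/-- The curve that draws the edge. -/
noncomputable def curve (e : Edge) : C(I, Plane) :=
  bent (vertexPos e.left) e.corner (vertexPos e.right)

lemma left_lt_right (e : Edge) : e.left < e.right := by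
  cases e <;> simp [left, right]

lemma left_fst_lt_corner_fst (e : Edge) : (vertexPos e.left).1 < e.corner.1 := by
  cases e <;> simp [left, corner, vertexPos] <;> first | positivity | linarith

lemma corner_fst_le_right_fst (e : Edge) : e.corner.1 ≤ (vertexPos e.right).1 := by
  cases e <;> simp [right, corner, vertexPos] <;> norm_num

lemma corner_ne_right (e : Edge) : e.corner ≠ vertexPos e.right := by
  rintro h
  have h1 := congrArg Prod.fst h
  have h2 := congrArg Prod.snd h
  cases e with
  | fan up j =>
    cases up <;> simp [right, corner, vertexPos] at h2 <;> nlinarith [(j.cast_nonneg : (0:ℝ) ≤ j)]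
  | spine i => norm_num [right, corner, vertexPos] at h1
  | tent up i => norm_num [right, corner, vertexPos] at h1
  | extra => norm_num [right, corner, vertexPos] at h1

lemma curve_injective (e : Edge) : Function.Injective e.curve :=
  bent_injective e.left_fst_lt_corner_fst e.corner_fst_le_right_fst e.corner_ne_right

/-- A description of the interior of the curve of an edge by equations and inequalities. -/
def Trace : Edge → Plane → Prop
  | spine 0, p => p.2 = 1 - p.1 ∧ 0 < p.1 ∧ p.1 < 1
  | spine (i + 1), p => p.2 = 0 ∧ i + 1 < p.1 ∧ p.1 < i + 2
  | fan up j, p => (side up * (p.2 - 1) = (j + 3) * p.1 ∧ 0 < p.1 ∧ p.1 ≤ j + 2) ∨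
      (p.1 = j + 2 ∧ 0 < side up * p.2 ∧ side up * p.2 ≤ (j + 3) * (j + 2) + side up)
  | tent up i, p => (side up * p.2 = 2 / 3 * (p.1 - (i + 1)) ∧ i + 1 < p.1 ∧ p.1 ≤ i + 5 / 2) ∨
      (side up * p.2 = 2 * (i + 3 - p.1) ∧ i + 5 / 2 ≤ p.1 ∧ p.1 < i + 3)
  | extra, p => (p.2 = 1 - 2 / 3 * p.1 ∧ 0 < p.1 ∧ p.1 ≤ 5 / 2) ∨
      (p.2 = 4 / 3 * (p.1 - 3) ∧ 5 / 2 ≤ p.1 ∧ p.1 < 3)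

/-- Only this inclusion is needed, since traces serve only to limit where curves can pass or meet.
-/
lemma trace_curve (e : Edge) {t : I} (ht : t ∈ Set.Ioo (0 : I) 1) : e.Trace (e.curve t) := by
  have h0 : (0 : ℝ) < t := ht.1
  have h1 : (t : ℝ) < 1 := ht.2
  rcases le_or_gt (t : ℝ) (1 / 2) with h | h
  · rw [curve, bent_of_le h]
    generalize (t : ℝ) = x at *
    rcases e with (_ | i) | ⟨_ | _, j⟩ | ⟨_ | _, i⟩ | _
    · simp [Trace, left, corner, vertexPos]
      refine ⟨?_, ?_, ?_⟩ <;> linarith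
    · simp [Trace, left, corner, vertexPos]
      refine ⟨?_, ?_⟩ <;> linarith
    · left
      simp [left, corner, vertexPos]
      refine ⟨by ring, by positivity, by nlinarith [(j.cast_nonneg : (0:ℝ) ≤ j)]⟩
    · left
      simp [left, corner, vertexPos]
      refine ⟨by ring, by positivity, by nlinarith [(j.cast_nonneg : (0:ℝ) ≤ j)]⟩
    · left
      simp [left, corner, vertexPos]
      refine ⟨?_, ?_, ?_⟩ <;> linarith
    · left
      simp [left, corner, vertexPos]
      refine ⟨?_, ?_, ?_⟩ <;> linarith
    · left
      simp [left, corner, vertexPos]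
      refine ⟨?_, ?_, ?_⟩ <;> linarith
  · rw [curve, bent_of_ge h.le]
    generalize (t : ℝ) = x at *
    rcases e with (_ | i) | ⟨_ | _, j⟩ | ⟨_ | _, i⟩ | _
    · simp [Trace, right, corner, vertexPos]
      refine ⟨?_, ?_, ?_⟩ <;> linarith
    · simp [Trace, right, corner, vertexPos]
      refine ⟨?_, ?_⟩ <;> linarith
    · right
      have hj : (0 : ℝ) < (j + 3) * (j + 2) - 1 := by nlinarith [(j.cast_nonneg : (0:ℝ) ≤ j)]
      simp [right, corner, vertexPos]
      refine ⟨?_, ?_⟩ <;> nlinarith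
    · right
      have hj : (0 : ℝ) < (j + 3) * (j + 2) + 1 := by positivity
      simp [right, corner, vertexPos]
      refine ⟨?_, ?_⟩ <;> nlinarith
    · right
      simp [right, corner, vertexPos]
      refine ⟨?_, ?_, ?_⟩ <;> linarith
    · right
      simp [right, corner, vertexPos]
      refine ⟨?_, ?_, ?_⟩ <;> linarith
    · right
      simp [right, corner, vertexPos]
      refine ⟨?_, ?_, ?_⟩ <;> linarith

lemma not_trace_vertexPos (e : Edge) (k : ℕ) : ¬ e.Trace (vertexPos k) := by
  have hc : ∀ a b : ℕ, (a : ℝ) < k → (k : ℝ) < b → a < k ∧ k < b := fun a b h1 h2 =>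
    ⟨by exact_mod_cast h1, by exact_mod_cast h2⟩
  rcases Nat.eq_zero_or_pos k with rfl | hk
  · rcases e with (_ | i) | ⟨up, j⟩ | ⟨up, i⟩ | _
    · simp [Trace, vertexPos]
    · simp [Trace, vertexPos]
    · rintro (⟨-, h, -⟩ | ⟨h, -, -⟩) <;> simp [vertexPos] at h
      linarith
    · rintro (⟨-, h, -⟩ | ⟨-, h, -⟩) <;> simp [vertexPos] at h <;> linarith
    · rintro (⟨-, h, -⟩ | ⟨-, h, -⟩) <;> norm_num [vertexPos] at h
  · have hk' : (1 : ℝ) ≤ k := by exact_mod_cast hk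
    rcases e with (_ | i) | ⟨_ | _, j⟩ | ⟨_ | _, i⟩ | _ <;>
      simp only [Trace, vertexPos, hk.ne', if_false, side_true, side_false]
    · rintro ⟨_, _, _⟩; linarith
    · rintro ⟨_, h1, h2⟩
      have := hc (i + 1) (i + 2) (by push_cast; linarith) (by push_cast; linarith)
      omega
    · rintro (⟨h, -, -⟩ | ⟨-, h, -⟩)
      · have : (0 : ℝ) ≤ j * k := by positivity
        linarith
      · linarith
    · rintro (⟨h, -, -⟩ | ⟨-, h, -⟩)
      · have : (0 : ℝ) ≤ j * k := by positivity
        linarith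
      · linarith
    · rintro (⟨h, h1, h2⟩ | ⟨h, h1, h2⟩) <;> linarith
    · rintro (⟨h, h1, h2⟩ | ⟨h, h1, h2⟩) <;> linarith
    · rintro (⟨h, h1, h2⟩ | ⟨h, h1, h2⟩)
      · have : 2 * (k : ℝ) = 3 := by linarith
        have : 2 * k = 3 := by exact_mod_cast this
        omega
      · linarith

end Edge

/-! ### The list of crossings and their owners -/

/-- The crossings of the curves of the edges. -/
inductive Crossing : Type
  | fanTent (up : Bool) (j : ℕ)
  | tentTent (up : Bool) (i : ℕ)
  | extraSpine
  | extraFan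
  | extraUpperTent
  | extraLowerTent

namespace Crossing

open Edge

/-- The first of the two edges of a crossing. -/
def fst : Crossing → Edge
  | fanTent up j => fan up j
  | tentTent up i => tent up i
  | extraSpine => spine 1
  | extraFan => fan false 0
  | extraUpperTent => tent true 0
  | extraLowerTent => tent false 1

/-- The second of the two edges of a crossing. -/
def snd : Crossing → Edge
  | fanTent up j => tent up j
  | tentTent up i => tent up (i + 1)
  | _ => extra

/-- The point of the plane at which a crossing takes place. -/
noncomputable def point : Crossing → Plane
  | fanTent up j => (j + 2, side up * (2 / 3))
  | tentTent up i => (i + 11 / 4, side up * (1 / 2))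
  | extraSpine => (3 / 2, 0)
  | extraFan => (2, -1 / 3)
  | extraUpperTent => (5 / 4, 1 / 6)
  | extraLowerTent => (8 / 3, -4 / 9)

/-- The edge to which a crossing is assigned. -/
def owner : Crossing → Edge
  | fanTent true j => fan true j
  | fanTent false 0 => tent false 0
  | fanTent false (j + 1) => fan false (j + 1)
  | tentTent up i => tent up (i + 1)
  | extraSpine => spine 1
  | extraFan => fan false 0
  | extraUpperTent => tent true 0
  | extraLowerTent => extra

lemma owner_eq (c : Crossing) : c.owner = c.fst ∨ c.owner = c.snd := by
  rcases c with ⟨_ | _, _ | j⟩ | ⟨up, i⟩ | _ | _ | _ | _ <;> simp [owner, fst, snd]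

/-- In general a fan edge takes the crossing with its tent, and tent `i + 1` the one with tent `i`.
This leaves the first tents, the spine and the extra edge free. Of the four crossings on the extra
edge, three go to spine edge `1`, the first upper tent and the extra edge itself; the fourth goes to
the first lower fan edge, whose tent crossing moves to the first lower tent. -/
lemma owner_injective : Function.Injective owner := by
  rintro (⟨_ | _, _ | j⟩ | ⟨up, i⟩ | _ | _ | _ | _) (⟨_ | _, _ | j'⟩ | ⟨up', i'⟩ | _ | _ | _ | _) <;>
    simp [owner]

lemma point_injective : Function.Injective point := by
  intro c d h
  have h1 := congrArg Prod.fst h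
  have h2 := congrArg Prod.snd h
  rcases c with ⟨_ | _, j⟩ | ⟨_ | _, i⟩ | _ | _ | _ | _ <;>
  rcases d with ⟨_ | _, j'⟩ | ⟨_ | _, i'⟩ | _ | _ | _ | _ <;>
  first
  | rfl
  | (exfalso; norm_num [point] at h2; done)
  | simpa [point] using h1

end Crossing

/-! ### Pairwise intersections of the curves -/

namespace Edge

lemma natCast_sandwich {a b c d : ℕ} {x : ℝ} (h1 : (a : ℝ) < x) (h2 : x < b) (h3 : (c : ℝ) < x)
    (h4 : x < d) : a < d ∧ c < b :=
  ⟨by exact_mod_cast h1.trans h4, by exact_mod_cast h3.trans h2⟩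

lemma Trace.fst_mem {e : Edge} {p : Plane} (h : e.Trace p) :
    0 < p.1 ∧ (1 ≤ e.left → e.left < p.1 ∧ p.1 < e.right) := by
  rcases e with (_ | i) | ⟨up, j⟩ | ⟨up, i⟩ | _
  · exact ⟨h.2.1, fun h => absurd h (by simp [left])⟩
  · obtain ⟨-, h1, h2⟩ := h
    refine ⟨by linarith [(i.cast_nonneg : (0:ℝ) ≤ i)], fun _ => ?_⟩
    simp only [left, right]; push_cast
    constructor <;> linarith
  · refine ⟨?_, fun h => absurd h (by simp [left])⟩
    obtain ⟨-, h, -⟩ | ⟨h, -, -⟩ := h <;> linarith [(j.cast_nonneg : (0:ℝ) ≤ j)]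
  · have h : (i : ℝ) + 1 < p.1 ∧ p.1 < i + 3 := by
      obtain ⟨-, h1, h2⟩ | ⟨-, h1, h2⟩ := h <;> constructor <;> linarith
    refine ⟨by linarith [(i.cast_nonneg : (0:ℝ) ≤ i)], fun _ => ?_⟩
    simp only [left, right]; push_cast
    exact h
  · refine ⟨?_, fun h => absurd h (by simp [left])⟩
    obtain ⟨-, h, -⟩ | ⟨-, h, -⟩ := h <;> linarith

lemma Trace.spine_spine {i k : ℕ} {p : Plane} (h : (spine i).Trace p) (h' : (spine k).Trace p) :
    i = k := by
  rcases i with _ | i <;> rcases k with _ | k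
  · rfl
  · obtain ⟨h1, h2, h3⟩ := h
    obtain ⟨h4, h5, h6⟩ := h'
    linarith [(k.cast_nonneg : (0:ℝ) ≤ k)]
  · obtain ⟨h1, h2, h3⟩ := h
    obtain ⟨h4, h5, h6⟩ := h'
    linarith [(i.cast_nonneg : (0:ℝ) ≤ i)]
  · have h1 := h.fst_mem.2 (by simp [left])
    have h2 := h'.fst_mem.2 (by simp [left])
    have := natCast_sandwich h1.1 h1.2 h2.1 h2.2
    simp only [left, right] at this
    omega

lemma Trace.spine_fan {i : ℕ} {up : Bool} {j : ℕ} {p : Plane} (h : (spine i).Trace p)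
    (h' : (fan up j).Trace p) : False := by
  have hj : (0 : ℝ) ≤ j := j.cast_nonneg
  have hj' : 0 ≤ (j : ℝ) * p.1 := mul_nonneg hj h.fst_mem.1.le
  rcases i with _ | i
  · obtain ⟨h1, h2, h3⟩ := h
    rcases up <;> simp only [Trace, side_true, side_false] at h' <;>
      obtain ⟨h4, h5, h6⟩ | ⟨h4, h5, h6⟩ := h' <;> linarith
  · have hi : (0 : ℝ) ≤ i := i.cast_nonneg
    obtain ⟨h1, h2, h3⟩ := h
    rcases up <;> simp only [Trace, side_true, side_false] at h' <;>
      obtain ⟨h4, h5, h6⟩ | ⟨h4, h5, h6⟩ := h' <;> linarith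

lemma Trace.spine_tent {i : ℕ} {up : Bool} {k : ℕ} {p : Plane} (h : (spine i).Trace p)
    (h' : (tent up k).Trace p) : False := by
  have hk : (0 : ℝ) ≤ k := k.cast_nonneg
  rcases i with _ | i
  · obtain ⟨h1, h2, h3⟩ := h
    rcases up <;> simp only [Trace, side_true, side_false] at h' <;>
      obtain ⟨h4, h5, h6⟩ | ⟨h4, h5, h6⟩ := h' <;> linarith
  · obtain ⟨h1, h2, h3⟩ := h
    rcases up <;> simp only [Trace, side_true, side_false] at h' <;>
      obtain ⟨h4, h5, h6⟩ | ⟨h4, h5, h6⟩ := h' <;> linarith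

lemma Trace.spine_extra {i : ℕ} {p : Plane} (h : (spine i).Trace p) (h' : extra.Trace p) :
    i = 1 ∧ p = (3 / 2, 0) := by
  rcases i with _ | i
  · obtain ⟨h1, h2, h3⟩ := h
    obtain ⟨h4, h5, h6⟩ | ⟨h4, h5, h6⟩ := h' <;> linarith
  · obtain ⟨h1, h2, h3⟩ := h
    obtain ⟨h4, h5, h6⟩ | ⟨h4, h5, h6⟩ := h'
    · have hp : p.1 = 3 / 2 := by linarith
      have : (i : ℝ) < 1 := by linarith
      have : i < 1 := by exact_mod_cast this
      exact ⟨by omega, Prod.ext hp h1⟩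
    · linarith

lemma Trace.fan_fan {up up' : Bool} {j k : ℕ} {p : Plane} (h : (fan up j).Trace p)
    (h' : (fan up' k).Trace p) : up = up' ∧ j = k := by
  have hj : (0 : ℝ) ≤ j := j.cast_nonneg
  have hk : (0 : ℝ) ≤ k := k.cast_nonneg
  have hp := h.fst_mem.1
  have hj' : 0 ≤ (j : ℝ) * p.1 := mul_nonneg hj hp.le
  have hk' : 0 ≤ (k : ℝ) * p.1 := mul_nonneg hk hp.le
  have same : up = up' := by
    rcases up <;> rcases up' <;> simp only [Trace, side_true, side_false] at h h' <;>
      first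
      | rfl
      | exfalso
        obtain ⟨h1, h2, h3⟩ | ⟨h1, h2, h3⟩ := h <;>
          obtain ⟨h4, h5, h6⟩ | ⟨h4, h5, h6⟩ := h' <;> linarith
  subst same
  refine ⟨rfl, ?_⟩
  suffices (j : ℝ) = k by exact_mod_cast this
  -- The slanted leg of `a` meets the vertical leg of `b`: the slopes give `a ≤ b`, the extent of
  -- the slanted leg gives `b ≤ a`.
  have key : ∀ a b : ℝ, (a + 3) * p.1 ≤ (b + 3) * (b + 2) → p.1 = b + 2 → p.1 ≤ a + 2 →
      a = b := by
    intro a b h1 h2 h3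
    rw [← h2] at h1
    have := le_of_mul_le_mul_right h1 hp
    linarith
  obtain ⟨h1, h2, h3⟩ | ⟨h1, h2, h3⟩ := h <;> obtain ⟨h4, h5, h6⟩ | ⟨h4, h5, h6⟩ := h'
  · have := mul_right_cancel₀ hp.ne' (h1.symm.trans h4)
    linarith
  · exact key _ _ (by linarith) h4 h3
  · exact (key _ _ (by linarith) h1 h6).symm
  · linarith

lemma Trace.fan_tent {up up' : Bool} {j k : ℕ} {p : Plane} (h : (fan up j).Trace p)
    (h' : (tent up' k).Trace p) : up = up' ∧ j = k ∧ p = ((j : ℝ) + 2, side up * (2 / 3)) := by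
  have hj : (0 : ℝ) ≤ j := j.cast_nonneg
  have hk : (0 : ℝ) ≤ k := k.cast_nonneg
  have hp := h.fst_mem.1
  have hj' : 0 ≤ (j : ℝ) * p.1 := mul_nonneg hj hp.le
  -- Tents live over `p.1 > 1` with `|p.2| ≤ 1`; there a slanted leg, of slope at least `3` in
  -- absolute value, has already left this strip.
  have vert : p.1 = j + 2 ∧ 0 < side up * p.2 := by
    obtain ⟨h1, h2, h3⟩ | ⟨h1, h2, h3⟩ := h
    · exfalso
      rcases up <;> rcases up' <;> simp only [Trace, side_true, side_false] at h1 h' <;>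
        obtain ⟨h4, h5, h6⟩ | ⟨h4, h5, h6⟩ := h' <;> linarith
    · exact ⟨h1, h2⟩
  have same : up = up' := by
    rcases up <;> rcases up' <;> simp only [Trace, side_true, side_false] at vert h' <;>
      first
      | rfl
      | exfalso
        obtain ⟨h4, h5, h6⟩ | ⟨h4, h5, h6⟩ := h' <;> linarith
  subst same
  have hjk : j = k := by
    have h1 := h'.fst_mem.2 (by simp [left])
    rw [vert.1] at h1
    simp only [left, right] at h1
    have h2 : k + 1 < j + 2 := by exact_mod_cast h1.1
    have h3 : j + 2 < k + 3 := by exact_mod_cast h1.2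
    omega
  subst hjk
  refine ⟨rfl, rfl, Prod.ext vert.1 ?_⟩
  have h1 := vert.1
  rcases up <;> simp only [Trace, side_true, side_false] at h' ⊢ <;>
    obtain ⟨h4, h5, h6⟩ | ⟨h4, h5, h6⟩ := h' <;> linarith

lemma Trace.fan_extra {up : Bool} {j : ℕ} {p : Plane} (h : (fan up j).Trace p)
    (h' : extra.Trace p) : up = false ∧ j = 0 ∧ p = (2, -1 / 3) := by
  have hj : (0 : ℝ) ≤ j := j.cast_nonneg
  have hp := h.fst_mem.1
  have hj' : 0 ≤ (j : ℝ) * p.1 := mul_nonneg hj hp.le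
  have lt3 : p.1 < 3 := by obtain ⟨h4, h5, h6⟩ | ⟨h4, h5, h6⟩ := h' <;> linarith
  rcases up <;> simp only [Trace, side_true, side_false] at h
  · have vert : p.1 = j + 2 := by
      obtain ⟨h1, h2, h3⟩ | ⟨h1, h2, h3⟩ := h
      · exfalso
        obtain ⟨h4, h5, h6⟩ | ⟨h4, h5, h6⟩ := h' <;> linarith
      · exact h1
    have h0 : j = 0 := by
      have : (j : ℝ) < 1 := by linarith
      have : j < 1 := by exact_mod_cast this
      omega
    subst h0
    have hx : p.1 = 2 := by simpa using vert
    refine ⟨rfl, rfl, Prod.ext hx ?_⟩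
    obtain ⟨h4, h5, h6⟩ | ⟨h4, h5, h6⟩ := h' <;> simp only <;> linarith
  · exfalso
    obtain ⟨h1, h2, h3⟩ | ⟨h1, h2, h3⟩ := h <;>
      obtain ⟨h4, h5, h6⟩ | ⟨h4, h5, h6⟩ := h' <;> linarith

lemma Trace.tent_tent {up up' : Bool} {i k : ℕ} {p : Plane} (h : (tent up i).Trace p)
    (h' : (tent up' k).Trace p) (hik : i ≤ k) :
    up = up' ∧ (i = k ∨ k = i + 1 ∧ p = ((i : ℝ) + 11 / 4, side up * (1 / 2))) := by
  have same : up = up' := by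
    rcases up <;> rcases up' <;> simp only [Trace, side_true, side_false] at h h' <;>
      first
      | rfl
      | exfalso
        obtain ⟨h1, h2, h3⟩ | ⟨h1, h2, h3⟩ := h <;>
          obtain ⟨h4, h5, h6⟩ | ⟨h4, h5, h6⟩ := h' <;> linarith
  subst same
  refine ⟨rfl, ?_⟩
  have h1 := h.fst_mem.2 (by simp [left])
  have h2 := h'.fst_mem.2 (by simp [left])
  have := natCast_sandwich h1.1 h1.2 h2.1 h2.2
  simp only [left, right] at this
  rcases hik.eq_or_lt with hik | hik
  · exact Or.inl hik
  right
  obtain rfl : k = i + 1 := by omega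
  refine ⟨rfl, ?_⟩
  rcases up <;> simp only [Trace, side_true, side_false] at h h' <;> push_cast at h' <;>
    obtain ⟨h1, h2, h3⟩ | ⟨h1, h2, h3⟩ := h <;>
    obtain ⟨h4, h5, h6⟩ | ⟨h4, h5, h6⟩ := h' <;>
    first
    | (exfalso; linarith)
    | (apply Prod.ext <;> simp only [side_true, side_false] <;> linarith)

lemma Trace.tent_extra {up : Bool} {i : ℕ} {p : Plane} (h : (tent up i).Trace p)
    (h' : extra.Trace p) :
    up = true ∧ i = 0 ∧ p = (5 / 4, 1 / 6) ∨ up = false ∧ i = 1 ∧ p = (8 / 3, -4 / 9) := by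
  have hi : i < 2 := by
    have h1 := (h.fst_mem.2 (by simp [left])).1
    have lt3 : p.1 < 3 := by obtain ⟨h4, h5, h6⟩ | ⟨h4, h5, h6⟩ := h' <;> linarith
    have : ((i + 1 : ℕ) : ℝ) < (3 : ℕ) := by simp only [left] at h1; push_cast at *; linarith
    have : i + 1 < 3 := by exact_mod_cast this
    omega
  rcases up <;> interval_cases i <;> simp only [Trace, side_true, side_false] at h <;>
    push_cast at h <;> obtain ⟨h1, h2, h3⟩ | ⟨h1, h2, h3⟩ := h <;>
    obtain ⟨h4, h5, h6⟩ | ⟨h4, h5, h6⟩ := h' <;>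
    first
    | (exfalso; linarith)
    | (left; exact ⟨rfl, rfl, Prod.ext (by simp only; linarith) (by simp only; linarith)⟩)
    | (right; exact ⟨rfl, rfl, Prod.ext (by simp only; linarith) (by simp only; linarith)⟩)

end Edge

namespace Crossing

open Edge

lemma exists_of_trace {e f : Edge} {p : Plane} (he : e.Trace p) (hf : f.Trace p) (hne : e ≠ f) :
    ∃ c : Crossing, c.point = p ∧ (e = c.fst ∧ f = c.snd ∨ e = c.snd ∧ f = c.fst) := by
  have tents : ∀ {up up' i k}, (tent up i).Trace p → (tent up' k).Trace p → i ≤ k →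
      tent up i ≠ tent up' k →
      ∃ c : Crossing, c.point = p ∧ (tent up i = c.fst ∧ tent up' k = c.snd) := by
    intro up up' i k h h' hik hne
    obtain ⟨rfl, rfl | ⟨rfl, rfl⟩⟩ := h.tent_tent h' hik
    · exact absurd rfl hne
    · exact ⟨tentTent up i, rfl, rfl, rfl⟩
  rcases e with i | ⟨up, j⟩ | ⟨up, i⟩ | _ <;> rcases f with i' | ⟨up', j'⟩ | ⟨up', i'⟩ | _
  · exact absurd (congrArg _ (he.spine_spine hf)) hne
  · exact (he.spine_fan hf).elim
  · exact (he.spine_tent hf).elim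
  · obtain ⟨rfl, rfl⟩ := he.spine_extra hf
    exact ⟨extraSpine, rfl, Or.inl ⟨rfl, rfl⟩⟩
  · exact (hf.spine_fan he).elim
  · obtain ⟨rfl, rfl⟩ := he.fan_fan hf
    exact absurd rfl hne
  · obtain ⟨rfl, rfl, rfl⟩ := he.fan_tent hf
    exact ⟨fanTent up j, rfl, Or.inl ⟨rfl, rfl⟩⟩
  · obtain ⟨rfl, rfl, rfl⟩ := he.fan_extra hf
    exact ⟨extraFan, rfl, Or.inl ⟨rfl, rfl⟩⟩
  · exact (hf.spine_tent he).elim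
  · obtain ⟨rfl, rfl, rfl⟩ := hf.fan_tent he
    exact ⟨fanTent up' j', rfl, Or.inr ⟨rfl, rfl⟩⟩
  · rcases le_total i i' with h | h
    · obtain ⟨c, hc, h⟩ := tents he hf h hne
      exact ⟨c, hc, Or.inl h⟩
    · obtain ⟨c, hc, h⟩ := tents hf he h hne.symm
      exact ⟨c, hc, Or.inr h.symm⟩
  · obtain ⟨rfl, rfl, rfl⟩ | ⟨rfl, rfl, rfl⟩ := he.tent_extra hf
    · exact ⟨extraUpperTent, rfl, Or.inl ⟨rfl, rfl⟩⟩
    · exact ⟨extraLowerTent, rfl, Or.inl ⟨rfl, rfl⟩⟩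
  · obtain ⟨rfl, rfl⟩ := hf.spine_extra he
    exact ⟨extraSpine, rfl, Or.inr ⟨rfl, rfl⟩⟩
  · obtain ⟨rfl, rfl, rfl⟩ := hf.fan_extra he
    exact ⟨extraFan, rfl, Or.inr ⟨rfl, rfl⟩⟩
  · obtain ⟨rfl, rfl, rfl⟩ | ⟨rfl, rfl, rfl⟩ := hf.tent_extra he
    · exact ⟨extraUpperTent, rfl, Or.inr ⟨rfl, rfl⟩⟩
    · exact ⟨extraLowerTent, rfl, Or.inr ⟨rfl, rfl⟩⟩
  · exact absurd rfl hne

end Crossing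

/-! ### Transversality of the crossings -/

lemma Edge.velocity_of_lt {e : Edge} {t : I} {p : Plane} (hp : e.curve t = p)
    (h : p.1 < e.corner.1) :
    HasLocalVelocity e.curve t ((2 : ℝ) • (e.corner - vertexPos e.left)) :=
  hasLocalVelocity_bent_of_lt (lt_half_of_bent_fst_lt e.corner_fst_le_right_fst (hp ▸ h))

lemma Edge.velocity_of_ge {e : Edge} {t : I} {p : Plane} (hp : e.curve t = p)
    (h : e.corner.1 ≤ p.1) (hne : p ≠ e.corner) :
    HasLocalVelocity e.curve t ((2 : ℝ) • (vertexPos e.right - e.corner)) :=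
  hasLocalVelocity_bent_of_gt
    (half_lt_of_le_bent_fst e.left_fst_lt_corner_fst (hp ▸ h) (hp ▸ hne))

namespace Crossing

open Edge

/-- No crossing is at a corner, so both curves are locally straight, with independent velocities.
For this reason a tent has its apex at `i + 5 / 2`, not over `i + 2` where a fan edge descends, and
the fictitious corner of a straight spine edge is not at its midpoint, where the extra edge crosses
spine edge `1`. -/
lemma crossTransversely (c : Crossing) {s t : I} (hs : c.fst.curve s = c.point)
    (ht : c.snd.curve t = c.point) : CrossTransversely c.fst.curve c.snd.curve s t := by
  have hp := hs.trans ht.symm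
  cases c with
  | fanTent up j =>
    refine (velocity_of_ge hs ?_ ?_).crossTransversely (velocity_of_lt ht ?_) hp ?_
    · simp [point, fst, corner]
    · intro h
      have h2 := congrArg Prod.snd h
      have hj : (0 : ℝ) ≤ j := j.cast_nonneg
      rcases up <;> simp [point, fst, corner] at h2 <;> nlinarith
    · simp [point, snd, corner]; norm_num
    · have : (0 : ℝ) < (j + 3) * (j + 2) - 1 := by nlinarith [(j.cast_nonneg : (0:ℝ) ≤ j)]
      rcases up <;> simp [fst, snd, corner, left, right, vertexPos]
      · exact ⟨by linarith, by norm_num⟩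
      · exact ⟨by linarith, by norm_num⟩
  | tentTent up i =>
    refine (velocity_of_ge hs ?_ ?_).crossTransversely (velocity_of_lt ht ?_) hp ?_
    · simp [point, fst, corner]; norm_num
    · intro h
      have h1 := congrArg Prod.fst h
      norm_num [point, fst, corner] at h1
    · simp [point, snd, corner]; linarith
    · rcases up <;> simp [fst, snd, corner, left, right, vertexPos] <;> ring_nf <;> norm_num
  | extraSpine =>
    refine (velocity_of_ge hs ?_ ?_).crossTransversely (velocity_of_lt ht ?_) hp ?_
    · norm_num [point, fst, corner]
    · intro h
      have h1 := congrArg Prod.fst h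
      norm_num [point, fst, corner] at h1
    · norm_num [point, snd, corner]
    · norm_num [fst, snd, corner, left, right, vertexPos]
  | extraFan =>
    refine (velocity_of_ge hs ?_ ?_).crossTransversely (velocity_of_lt ht ?_) hp ?_
    · norm_num [point, fst, corner]
    · intro h
      have h1 := congrArg Prod.snd h
      norm_num [point, fst, corner] at h1
    · norm_num [point, snd, corner]
    · norm_num [fst, snd, corner, left, right, vertexPos]
  | extraUpperTent =>
    refine (velocity_of_lt hs ?_).crossTransversely (velocity_of_lt ht ?_) hp ?_
    · norm_num [point, fst, corner]
    · norm_num [point, snd, corner]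
    · norm_num [fst, snd, corner, left, right, vertexPos]
  | extraLowerTent =>
    refine (velocity_of_lt hs ?_).crossTransversely (velocity_of_ge ht ?_ ?_) hp ?_
    · norm_num [point, fst, corner]
    · norm_num [point, snd, corner]
    · intro h
      have h1 := congrArg Prod.fst h
      norm_num [point, snd, corner] at h1
    · norm_num [fst, snd, corner, left, right, vertexPos]

end Crossing

/-! ### Parallel edges are not homotopic -/

/-- A homotopic pair of curves cannot pass on different sides of a vertex between their ends. -/
lemma Drawing.not_homotopic_of_above_below {α β : Type*} {G : Graph α β} (D : Drawing G)
    {e f : G.edgeSet} (z : G.vertexSet) (h0 : D.arc e 0 = D.arc f 0) (h1 : D.arc e 1 = D.arc f 1)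
    (hA : (D.arc e 0).1 < (D.pos z).1) (hB : (D.pos z).1 < (D.arc e 1).1)
    (habove : ∀ t, (D.arc e t).1 = (D.pos z).1 → (D.pos z).2 < (D.arc e t).2)
    (hbelow : ∀ t, (D.arc f t).1 = (D.pos z).1 → (D.arc f t).2 < (D.pos z).2) :
    ¬ D.Homotopic e f ∧ ¬ D.Homotopic f e := by
  have key : ∀ h : C(I × I, Plane), (∀ t, h (0, t) = D.arc e t) → (∀ t, h (1, t) = D.arc f t) →
      (∀ s, h (s, 0) = D.arc e 0) → (∀ s, h (s, 1) = D.arc e 1) →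
      ∃ s ∈ Set.Ioo (0 : I) 1, ∃ t ∈ Set.Ioo (0 : I) 1, h (s, t) = D.pos z := by
    intro h he hf hl hr
    obtain ⟨s, t, hst⟩ := ne_of_above_below hA hB h hl hr
      (fun t => by rw [he]; exact habove t) (fun t => by rw [hf]; exact hbelow t)
    refine ⟨s, ⟨unitInterval.pos_iff_ne_zero.2 ?_, unitInterval.lt_one_iff_ne_one.2 ?_⟩,
      t, ⟨unitInterval.pos_iff_ne_zero.2 ?_, unitInterval.lt_one_iff_ne_one.2 ?_⟩, hst⟩
    · rintro rfl
      rw [he] at hst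
      exact (habove t (by rw [hst])).ne (by rw [hst])
    · rintro rfl
      rw [hf] at hst
      exact (hbelow t (by rw [hst])).ne (by rw [hst])
    · rintro rfl
      exact hA.ne (by rw [← hst, hl])
    · rintro rfl
      exact hB.ne (by rw [← hst, hr])
  constructor
  · rintro ⟨h, he, hf | hf, hl, hr, hav⟩
    · obtain ⟨s, hs, t, ht, hst⟩ := key h he hf hl hr
      exact hav s hs t ht z hst
    -- The reversed traversal would identify the two ends, which have different abscissae.
    · have := hf 0
      rw [hl, unitInterval.symm_zero, ← h1] at this
      exact (hA.trans hB).ne (by rw [this])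
  · rintro ⟨h, hf, he | he, hl, hr, hav⟩
    · let k : C(I × I, Plane) := ⟨fun p => h (unitInterval.symm p.1, p.2), by fun_prop⟩
      obtain ⟨s, hs, t, ht, hst⟩ := key k
        (fun t => by change h (unitInterval.symm 0, t) = _; rw [unitInterval.symm_zero, he])
        (fun t => by change h (unitInterval.symm 1, t) = _; rw [unitInterval.symm_one, hf])
        (fun s => (hl _).trans h0.symm) (fun s => (hr _).trans h1.symm)
      refine hav (unitInterval.symm s) ⟨?_, ?_⟩ t ht z hst
      · have : (s : ℝ) < 1 := hs.2
        exact Subtype.mk_lt_mk.2 (by linarith)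
      · have : (0 : ℝ) < s := hs.1
        exact Subtype.mk_lt_mk.2 (by linarith)
    · have := he 0
      rw [hl, unitInterval.symm_zero, ← h0] at this
      exact (hA.trans hB).ne (by rw [this])

namespace Edge

/-- The curve of the edge `e` passes above the vertex `k`. -/
def Above (e : Edge) (k : ℕ) : Prop := ∀ p : Plane, e.Trace p → p.1 = k → 0 < p.2

/-- The curve of the edge `e` passes below the vertex `k`. -/
def Below (e : Edge) (k : ℕ) : Prop := ∀ p : Plane, e.Trace p → p.1 = k → p.2 < 0

lemma above_fan (j : ℕ) {k : ℕ} : (fan true j).Above k := by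
  intro p h hk
  simp only [Trace, side_true] at h
  obtain ⟨h1, h2, h3⟩ | ⟨h1, h2, h3⟩ := h
  · have : 0 ≤ (j : ℝ) * p.1 := by positivity
    linarith
  · linarith

lemma below_fan (j : ℕ) {k : ℕ} (hk : 1 ≤ k) : (fan false j).Below k := by
  intro p h hp
  simp only [Trace, side_false] at h
  have : (1 : ℝ) ≤ p.1 := by rw [hp]; exact_mod_cast hk
  obtain ⟨h1, h2, h3⟩ | ⟨h1, h2, h3⟩ := h
  · have : 0 ≤ (j : ℝ) * p.1 := by positivity
    linarith
  · linarith

lemma above_tent (i k : ℕ) : (tent true i).Above k := by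
  intro p h _
  simp only [Trace, side_true] at h
  obtain ⟨h1, h2, h3⟩ | ⟨h1, h2, h3⟩ := h <;> linarith

lemma below_tent (i k : ℕ) : (tent false i).Below k := by
  intro p h _
  simp only [Trace, side_false] at h
  obtain ⟨h1, h2, h3⟩ | ⟨h1, h2, h3⟩ := h <;> linarith

lemma above_extra : extra.Above 1 := by
  intro p h hp
  rw [Nat.cast_one] at hp
  obtain ⟨h1, h2, h3⟩ | ⟨h1, h2, h3⟩ := h <;> linarith

lemma below_extra : extra.Below 2 := by
  intro p h hp
  rw [Nat.cast_two] at hp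
  obtain ⟨h1, h2, h3⟩ | ⟨h1, h2, h3⟩ := h <;> linarith

/-- Parallel pairs are the two sides of a fan or tent edge, and the extra edge with either fan edge
to `3`: vertex `1` separates it from the lower one, vertex `2` from the upper one. -/
lemma exists_separating {e f : Edge} (hne : e ≠ f) (hl : e.left = f.left)
    (hr : e.right = f.right) :
    ∃ k, 1 ≤ k ∧ e.left < k ∧ k < e.right ∧ (e.Above k ∧ f.Below k ∨ f.Above k ∧ e.Below k) := by
  rcases e with i | ⟨up, j⟩ | ⟨up, i⟩ | _ <;> rcases f with i' | ⟨up', j'⟩ | ⟨up', i'⟩ | _ <;>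
    simp only [left, right] at hl hr <;> try (exfalso; omega)
  · exact absurd (by rw [hl]) hne
  · obtain rfl : j = j' := by omega
    refine ⟨1, le_rfl, by simp [left], by simp [right], ?_⟩
    rcases up <;> rcases up'
    · exact absurd rfl hne
    · exact Or.inr ⟨above_fan j, below_fan j le_rfl⟩
    · exact Or.inl ⟨above_fan j, below_fan j le_rfl⟩
    · exact absurd rfl hne
  · obtain rfl : j = 1 := by omega
    rcases up
    · exact ⟨1, le_rfl, by simp [left], by simp [right], Or.inr ⟨above_extra, below_fan 1 le_rfl⟩⟩
    · exact ⟨2, by simp, by simp [left], by simp [right], Or.inl ⟨above_fan 1, below_extra⟩⟩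
  · obtain rfl : i = i' := by omega
    refine ⟨i + 2, by omega, by simp [left], by simp [right], ?_⟩
    rcases up <;> rcases up'
    · exact absurd rfl hne
    · exact Or.inr ⟨above_tent _ _, below_tent _ _⟩
    · exact Or.inl ⟨above_tent _ _, below_tent _ _⟩
    · exact absurd rfl hne
  · obtain rfl : j' = 1 := by omega
    rcases up'
    · exact ⟨1, le_rfl, by simp [left], by simp [right], Or.inl ⟨above_extra, below_fan 1 le_rfl⟩⟩
    · exact ⟨2, by simp, by simp [left], by simp [right], Or.inr ⟨above_fan 1, below_extra⟩⟩
  · exact absurd rfl hne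

lemma curve_zero (e : Edge) : e.curve 0 = vertexPos e.left := bent_zero _ _ _

lemma curve_one (e : Edge) : e.curve 1 = vertexPos e.right := bent_one _ _ _

/-- A property of all the points of the interior of a curve on a vertical line strictly between
its ends holds for all points of the curve on that line. -/
lemma forall_curve {e : Edge} {k : ℕ} (hl : e.left < k) (hr : k < e.right) {P : Plane → Prop}
    (h : ∀ p : Plane, e.Trace p → p.1 = k → P p) (t : I) (ht : (e.curve t).1 = k) :
    P (e.curve t) := by
  refine h _ (e.trace_curve ⟨unitInterval.pos_iff_ne_zero.2 ?_,
    unitInterval.lt_one_iff_ne_one.2 ?_⟩) ht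
  · rintro rfl
    rw [curve_zero] at ht
    exact hl.ne (Nat.cast_injective (R := ℝ) ht)
  · rintro rfl
    rw [curve_one] at ht
    exact hr.ne' (Nat.cast_injective (R := ℝ) ht)

lemma eq_of_curve_eq {e f : Edge} {s t : I} (h : e.curve s = f.curve t) (hne : (e, s) ≠ (f, t)) :
    e ≠ f := by
  rintro rfl
  exact hne (by rw [e.curve_injective h])

end Edge

/-! ### The finite multigraphs, their drawings and the gap assignment -/

/-- The multigraph on the vertices `0, …, n - 1` with all the edges that have both ends there. -/
def edgeGraph (n : ℕ) : Graph ℕ Edge where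
  vertexSet := {k | k < n}
  edgeSet := {e | e.right < n}
  IsLink e x y := e.right < n ∧ (x = e.left ∧ y = e.right ∨ x = e.right ∧ y = e.left)
  isLink_symm _ _ := ⟨fun _ _ h => ⟨h.1, h.2.symm.imp And.symm And.symm⟩⟩
  eq_or_eq_of_isLink_of_isLink := by
    rintro e x y v w ⟨-, h⟩ ⟨-, h'⟩
    omega
  edge_mem_iff_exists_isLink e :=
    ⟨fun h => ⟨_, _, h, Or.inl ⟨rfl, rfl⟩⟩, fun ⟨_, _, h, _⟩ => h⟩
  left_mem_of_isLink := by
    rintro e x y ⟨h, h'⟩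
    have := e.left_lt_right
    change x < n
    omega

lemma loopless_edgeGraph (n : ℕ) : (edgeGraph n).Loopless where
  not_isLoopAt e x h := by
    obtain ⟨-, h⟩ := h
    have := e.left_lt_right
    omega

lemma encard_vertexSet_edgeGraph (n : ℕ) : (edgeGraph n).vertexSet.encard = n := by
  have : (edgeGraph n).vertexSet = (Finset.range n : Set ℕ) := by
    ext k; simp [edgeGraph]
  rw [this, Set.encard_coe_eq_coe_finsetCard, Finset.card_range]

lemma encard_edgeSet_edgeGraph {n : ℕ} (hn : 4 ≤ n) :
    (edgeGraph n).edgeSet.encard = (5 * n - 10 : ℕ) := by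
  let g : (Fin (n - 1) ⊕ (Bool × Fin (n - 2))) ⊕ ((Bool × Fin (n - 3)) ⊕ Unit) → Edge :=
    Sum.elim (Sum.elim (fun i => .spine i) (fun x => .fan x.1 x.2))
      (Sum.elim (fun x => .tent x.1 x.2) (fun _ => .extra))
  have hg : Function.Injective g := by
    rintro ((i | ⟨u, j⟩) | (⟨u, i⟩ | _)) ((i' | ⟨u', j'⟩) | (⟨u', i'⟩ | _)) <;>
      simp [g, Fin.ext_iff]
  have hr : (edgeGraph n).edgeSet = Set.range g := by
    ext e
    constructor
    · intro (h : e.right < n)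
      rcases e with i | ⟨up, j⟩ | ⟨up, i⟩ | _ <;> simp only [Edge.right] at h
      · exact ⟨.inl (.inl ⟨i, by omega⟩), rfl⟩
      · exact ⟨.inl (.inr (up, ⟨j, by omega⟩)), rfl⟩
      · exact ⟨.inr (.inl (up, ⟨i, by omega⟩)), rfl⟩
      · exact ⟨.inr (.inr ()), rfl⟩
    · rintro ⟨(i | ⟨u, j⟩) | (⟨u, i⟩ | _), rfl⟩ <;>
        simp only [edgeGraph, Set.mem_ofPred_eq, g, Sum.elim_inl, Sum.elim_inr, Edge.right] <;> omega
  rw [hr, ← Set.image_univ, hg.encard_image, Set.encard_univ, ENat.card_eq_coe_fintype_card]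
  simp only [Fintype.card_sum, Fintype.card_prod, Fintype.card_fin, Fintype.card_bool,
    Fintype.card_unit]
  congr 1
  omega

/-- The drawing of `edgeGraph n` by polygonal curves. -/
noncomputable def edgeDrawing (n : ℕ) : Drawing (edgeGraph n) where
  pos k := vertexPos k
  pos_injective := vertexPos_injective.comp Subtype.val_injective
  arc e := e.1.curve
  arc_ends e := ⟨⟨e.1.left, e.1.left_lt_right.trans e.2⟩, ⟨e.1.right, e.2⟩,
    ⟨e.2, Or.inl ⟨rfl, rfl⟩⟩, e.1.curve_zero, e.1.curve_one⟩
  arc_ne_pos e t ht x h := e.1.not_trace_vertexPos x (h ▸ e.1.trace_curve ht)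
  transverse := by
    rintro ⟨e, he⟩ ⟨f, hf⟩ s t hs ht hne (h : e.curve s = f.curve t)
    have hef : e ≠ f := Edge.eq_of_curve_eq h (by simpa using hne)
    obtain ⟨c, hc, ⟨rfl, rfl⟩ | ⟨rfl, rfl⟩⟩ := Crossing.exists_of_trace
      (e.trace_curve hs) (h ▸ f.trace_curve ht) hef
    · exact c.crossTransversely hc.symm (h.symm.trans hc.symm)
    · exact (c.crossTransversely (h.symm.trans hc.symm) hc.symm).symm
  no_three := by
    intro p
    by_contra! hlt
    obtain ⟨T, hT, hcard⟩ := Set.exists_subset_encard_eq (Order.add_one_le_of_lt hlt)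
    obtain ⟨⟨⟨e, he⟩, s⟩, ⟨⟨f, hf⟩, t⟩, ⟨⟨g, hg⟩, r⟩, h12, h13, h23, rfl⟩ :=
      Set.encard_eq_three.1 (hcard.trans (by norm_num))
    obtain ⟨hs, rfl⟩ := hT (by simp : (⟨⟨e, he⟩, s⟩ : (edgeGraph n).edgeSet × I) ∈ _)
    obtain ⟨ht, hft⟩ := hT (by simp : (⟨⟨f, hf⟩, t⟩ : (edgeGraph n).edgeSet × I) ∈ _)
    obtain ⟨hr, hgr⟩ := hT (by simp : (⟨⟨g, hg⟩, r⟩ : (edgeGraph n).edgeSet × I) ∈ _)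
    simp only at hs ht hr hft hgr
    have hef : e ≠ f := Edge.eq_of_curve_eq hft.symm (by simpa using h12)
    have heg : e ≠ g := Edge.eq_of_curve_eq hgr.symm (by simpa using h13)
    have hfg : f ≠ g := Edge.eq_of_curve_eq (hft.trans hgr.symm) (by simpa using h23)
    obtain ⟨c, hc, hc'⟩ := Crossing.exists_of_trace
      (e.trace_curve hs) (hft ▸ f.trace_curve ht) hef
    obtain ⟨d, hd, hd'⟩ := Crossing.exists_of_trace
      (e.trace_curve hs) (hgr ▸ g.trace_curve hr) heg
    -- A point carries only one crossing label, so the pairs `e, f` and `e, g` coincide, against `f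
    -- ≠ g`.
    obtain rfl := Crossing.point_injective (hc.trans hd.symm)
    obtain ⟨rfl, rfl⟩ | ⟨rfl, rfl⟩ := hc' <;> obtain ⟨h1, rfl⟩ | ⟨h1, rfl⟩ := hd'
    · exact hfg rfl
    · exact hef h1
    · exact hef h1
    · exact hfg rfl

lemma exists_owner {n : ℕ} (p : (edgeDrawing n).crossings) :
    ∃ (c : Crossing) (g : (edgeGraph n).edgeSet),
      c.point = p.1 ∧ g.1 = c.owner ∧ (edgeDrawing n).Responsible g p.1 := by
  obtain ⟨p, e, f, s, t, hs, ht, hne, rfl, h⟩ := p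
  have h' : e.1.curve s = f.1.curve t := h.symm
  have hef : e.1 ≠ f.1 := Edge.eq_of_curve_eq h' (by
    simpa [Subtype.ext_iff] using hne)
  have re : (edgeDrawing n).Responsible e ((edgeDrawing n).arc e s) := ⟨s, hs, rfl⟩
  have rf : (edgeDrawing n).Responsible f ((edgeDrawing n).arc e s) := ⟨t, ht, h⟩
  obtain ⟨c, hc, hc'⟩ := Crossing.exists_of_trace
    (e.1.trace_curve hs) (h' ▸ f.1.trace_curve ht) hef
  obtain ⟨h1, h2⟩ | ⟨h1, h2⟩ := hc' <;> obtain h3 | h3 := c.owner_eq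
  · exact ⟨c, e, hc, h1.trans h3.symm, re⟩
  · exact ⟨c, f, hc, h2.trans h3.symm, rf⟩
  · exact ⟨c, f, hc, h2.trans h3.symm, rf⟩
  · exact ⟨c, e, hc, h1.trans h3.symm, re⟩

lemma not_homotopic_edgeDrawing {n : ℕ} {e f : (edgeGraph n).edgeSet}
    (h : AreParallel (edgeGraph n) e.1 f.1) : ¬ (edgeDrawing n).Homotopic e f := by
  obtain ⟨hne, x, y, ⟨-, he⟩, ⟨-, hf⟩⟩ := h
  have hle := e.1.left_lt_right
  have hlf := f.1.left_lt_right
  have hl : e.1.left = f.1.left := by omega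
  have hr : e.1.right = f.1.right := by omega
  have key : ∀ (e f : (edgeGraph n).edgeSet) (k : ℕ), e.1.left = f.1.left →
      e.1.right = f.1.right → 1 ≤ k → e.1.left < k → k < e.1.right → e.1.Above k → f.1.Below k →
      ¬ (edgeDrawing n).Homotopic e f ∧ ¬ (edgeDrawing n).Homotopic f e := by
    intro e f k hl hr h1 hlk hkr ha hb
    have hpos : vertexPos k = ((k : ℝ), 0) := by
      simp [vertexPos, Nat.one_le_iff_ne_zero.1 h1]
    refine (edgeDrawing n).not_homotopic_of_above_below ⟨k, hkr.trans e.2⟩ ?_ ?_ ?_ ?_ ?_ ?_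
    · simp only [edgeDrawing, Edge.curve_zero, hl]
    · simp only [edgeDrawing, Edge.curve_one, hr]
    · simp only [edgeDrawing, Edge.curve_zero]
      exact Nat.cast_lt.2 hlk
    · simp only [edgeDrawing, Edge.curve_one]
      exact Nat.cast_lt.2 hkr
    · simp only [edgeDrawing, hpos]
      exact Edge.forall_curve hlk hkr ha
    · simp only [edgeDrawing, hpos]
      exact Edge.forall_curve (hl ▸ hlk) (hr ▸ hkr) hb
  obtain ⟨k, h1, hlk, hkr, ⟨ha, hb⟩ | ⟨ha, hb⟩⟩ := Edge.exists_separating hne hl hr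
  · exact (key e f k hl hr h1 hlk hkr ha hb).1
  · exact (key f e k hl.symm hr.symm h1 (hl ▸ hlk) (hr ▸ hkr) ha hb).2

lemma isGapPlanar_edgeGraph (n : ℕ) : IsGapPlanar (edgeGraph n) 1 := by
  refine ⟨edgeDrawing n, ?_, fun e f h => not_homotopic_edgeDrawing h⟩
  choose c g hc hg hres using exists_owner (n := n)
  refine ⟨g, hres, fun e => ?_⟩
  rw [Nat.cast_one, Set.encard_le_one_iff]
  intro a b (ha : g a = e) (hb : g b = e)
  have hab : c a = c b := Crossing.owner_injective (by rw [← hg, ← hg, ha, hb])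
  exact Subtype.ext (by rw [← hc, ← hc, hab])

end GapPlanar

theorem mainTheorem9 (n : ℕ) (hn : 5 ≤ n) :
    ∃ (V E : Type) (G : Graph V E),
      G.Loopless ∧ G.vertexSet.encard = n ∧ G.edgeSet.encard = (5 * n - 10 : ℕ) ∧
        GapPlanar.IsGapPlanar G 1 :=
  ⟨ℕ, GapPlanar.Edge, GapPlanar.edgeGraph n, GapPlanar.loopless_edgeGraph n,
    GapPlanar.encard_vertexSet_edgeGraph n, GapPlanar.encard_edgeSet_edgeGraph (by omega),
    GapPlanar.isGapPlanar_edgeGraph n⟩
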